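/- Let $n,m\ge 0$ and let $w=(i_1\,j_1)(i_2\,j_2)\cdots(i_m\,j_m)\in\mathcal S_n$ be an involution (or the identity, when $m=0$), written as a product of disjoint transpositions with $i_s<j_s$ for all $s$ and $i_1<i_2<\dots<i_m$. Let $k_1<k_2<\dots<k_{n-2m}$ be the fixed points of $w$. For $\pi\in\mathcal S_n$ let $M_\pi\in \mathrm{GL}_n(\mathbb C)$ be its permutation matrix, $M_\pi e_b=e_{\pi(b)}$; for an involution $v$ let $N_v$ be the matrix obtained from $M_v$ by replacing all entries on and below the diagonal by $0$. Let $w_m=(1,\,n-m+1)(2,\,n-m+2)\cdots(m,\,n)$. Let $\mathcal O_w=\{bN_wb^{-1} : b\in \mathrm B_n\}$ be the orbit of $N_w$ under conjugation by the group $\mathrm B_n\subset\mathrm{GL}_n(\mathbb C)$ of invertible upper triangular matrices, and let $\dim$ denote dimension in the Zariski topology. Let $\pi_w\in\mathcal S_n$ be the permutation with one-line notation $$i_1,i_2,\dots,i_m,\;k_1,k_2,\dots,k_{n-2m},\;j_1,j_2,\dots,j_m .$$ Then $$M_{\pi_w}\,N_{w_m}\,M_{\pi_w}^{-1}=N_w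 \qquad\text{and}\qquad \dim\mathcal O_w=\ell(\pi_w)+\frac{m(m+1)}2,$$ where $\ell$ is the Coxeter length on $\mathcal S_n$, i.e. the least length of a word in the transpositions $(a,\,a+1)$, $1\le a<n$, representing the permutation. -/

import Mathlib

/-- The permutation matrix `M_π ∈ GL_n(ℂ)`, with `M_π e_b = e_{π(b)}`. -/
def permGL {n : ℕ} (π : Equiv.Perm (Fin n)) : GL (Fin n) ℂ where
  val := Matrix.of fun a b => if a = π b then 1 else 0
  inv := Matrix.of fun a b => if π a = b then 1 else 0
  val_inv := by
    ext a b
    rw [Matrix.mul_apply, Finset.sum_eq_single (π.symm a)]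
    · simp [Matrix.one_apply]
    · intro c _ hc
      have : a ≠ π c := fun h => hc (by simp [h])
      simp [this]
    · simp
  inv_val := by
    ext a b
    rw [Matrix.mul_apply, Finset.sum_eq_single (π a)]
    · simp [Matrix.one_apply]
    · intro c _ hc
      simp [Ne.symm hc]
    · simp

/-- The matrix `N_w`: the strictly upper triangular part of the permutation matrix `M_w`. -/
def upperPart {n : ℕ} (w : Equiv.Perm (Fin n)) : Matrix (Fin n) (Fin n) ℂ :=
  Matrix.of fun a b => if b ≤ a then 0 else (permGL w : Matrix (Fin n) (Fin n) ℂ) a b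

/-- The involution `w_m = (1, n-m+1)(2, n-m+2)⋯(m, n)` (here with indices starting from `0`). -/
def minimalInvolution (n m : ℕ) (h : 2 * m ≤ n) : Equiv.Perm (Fin n) :=
  (List.ofFn fun a : Fin m =>
    Equiv.swap (⟨a, by omega⟩ : Fin n) ⟨n - m + a, by omega⟩).prod

/-- The standard Borel subgroup of `GL_n(ℂ)`: invertible upper triangular matrices. -/
def borelSubgroup (n : ℕ) : Subgroup (GL (Fin n) ℂ) where
  carrier := {b | ∀ r c : Fin n, c < r → (b : Matrix (Fin n) (Fin n) ℂ) r c = 0}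
  one_mem' := by
    intro r c h
    simp [h.ne']
  mul_mem' := by
    intro x y hx hy
    have hx' : (x : Matrix (Fin n) (Fin n) ℂ).BlockTriangular id := fun r c h => hx r c h
    have hy' : (y : Matrix (Fin n) (Fin n) ℂ).BlockTriangular id := fun r c h => hy r c h
    intro r c h
    exact hx'.mul hy' h
  inv_mem' := by
    intro x hx
    have hx' : (x : Matrix (Fin n) (Fin n) ℂ).BlockTriangular id := fun r c h => hx r c h
    have : Invertible (x : Matrix (Fin n) (Fin n) ℂ) := x.isUnit.invertible
    intro r c h
    rw [Matrix.coe_units_inv]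
    exact Matrix.blockTriangular_inv_of_blockTriangular hx' h

/-- The orbit of `N` under the conjugation action of the Borel subgroup. -/
def borelOrbit {n : ℕ} (N : Matrix (Fin n) (Fin n) ℂ) : Set (Matrix (Fin n) (Fin n) ℂ) :=
  {A | ∃ b ∈ borelSubgroup n, A = (b : Matrix (Fin n) (Fin n) ℂ) * N *
    ((b⁻¹ : GL (Fin n) ℂ) : Matrix (Fin n) (Fin n) ℂ)}

/-- The Zariski topology on the affine space of complex `n × n` matrices: the closed sets are
the common zero sets of families of polynomials in the entries. -/
noncomputable abbrev zariskiTopology (n : ℕ) : TopologicalSpace (Matrix (Fin n) (Fin n) ℂ) :=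
  TopologicalSpace.induced
    (fun A => MvPolynomial.pointToPoint (k := ℂ) (K := ℂ) fun p : Fin n × Fin n => A p.1 p.2)
    inferInstance

theorem isClosed_zariskiTopology_iff (n : ℕ) (Z : Set (Matrix (Fin n) (Fin n) ℂ)) :
    @IsClosed _ (zariskiTopology n) Z ↔
      ∃ S : Set (MvPolynomial (Fin n × Fin n) ℂ),
        Z = {A | ∀ f ∈ S, MvPolynomial.eval (fun p => A p.1 p.2) f = 0} := by
  have key : ∀ S : Set (MvPolynomial (Fin n × Fin n) ℂ),
      ((fun A : Matrix (Fin n) (Fin n) ℂ =>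
        MvPolynomial.pointToPoint (k := ℂ) (K := ℂ) fun p : Fin n × Fin n => A p.1 p.2) ⁻¹'
          PrimeSpectrum.zeroLocus S) =
      {A | ∀ f ∈ S, MvPolynomial.eval (fun p => A p.1 p.2) f = 0} := by
    intro S
    ext A
    simp [MvPolynomial.pointToPoint, PrimeSpectrum.mem_zeroLocus, Set.subset_def,
      MvPolynomial.mem_vanishingIdeal_iff, MvPolynomial.aeval_eq_eval]
  rw [zariskiTopology, isClosed_induced_iff]
  constructor
  · rintro ⟨t, ht, rfl⟩
    obtain ⟨S, rfl⟩ := (PrimeSpectrum.isClosed_iff_zeroLocus t).1 ht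
    exact ⟨S, key S⟩
  · rintro ⟨S, rfl⟩
    exact ⟨_, PrimeSpectrum.isClosed_zeroLocus S, key S⟩

/-- The dimension of a set of matrices: its Krull dimension as a topological space, with the
topology induced from the Zariski topology. -/
noncomputable def zariskiDim {n : ℕ} (S : Set (Matrix (Fin n) (Fin n) ℂ)) : WithBot ℕ∞ :=
  @topologicalKrullDim S (TopologicalSpace.induced Subtype.val (zariskiTopology n))

/-- `L` is a word in the simple transpositions `s_a = (a, a+1)` whose product is `π`. -/
def IsSimpleWord {n : ℕ} (π : Equiv.Perm (Fin n)) (L : List (Equiv.Perm (Fin n))) : Prop :=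
  (∀ s ∈ L, ∃ a b : Fin n, (a : ℕ) + 1 = b ∧ s = Equiv.swap a b) ∧ L.prod = π

theorem exists_isSimpleWord {n : ℕ} (π : Equiv.Perm (Fin n)) : ∃ L, IsSimpleWord π L := by
  cases n with
  | zero => exact ⟨[], by simp, Subsingleton.elim _ _⟩
  | succ n =>
    have h : π ∈ Submonoid.closure
        (Set.range fun i : Fin n => Equiv.swap i.castSucc i.succ) := by
      rw [Equiv.Perm.mclosure_swap_castSucc_succ]; trivial
    obtain ⟨L, hL, hp⟩ := Submonoid.exists_list_of_mem_closure h
    refine ⟨L, fun s hs => ?_, hp⟩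
    obtain ⟨i, rfl⟩ := hL s hs
    exact ⟨i.castSucc, i.succ, by simp, rfl⟩

/-- The Coxeter length of a permutation: the least length of a word in the simple
transpositions representing it (by `exists_isSimpleWord`, such words exist). -/
noncomputable def coxeterLength {n : ℕ} (π : Equiv.Perm (Fin n)) : ℕ :=
  sInf {l | ∃ L, IsSimpleWord π L ∧ L.length = l}

/-!
Let `N` be the matrix with ones in the positions `(i s, j s)`, so that a conjugate `b N b⁻¹` is the
sum over `s` of the products of the `i s`-th column of `b` with the `j s`-th row of `b⁻¹`. The
dimension of its Borel orbit is found by parametrizing the orbit by a slice of the Borel subgroup: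
the upper triangular matrices `b` whose free entries are those in the set `slicePositions i j`, with
nonzero free entries on the diagonal, all other entries being those of the identity matrix.

* Every orbit point comes from the slice (`exists_isSlice_conj_eq`): the columns `i s` can be
  reduced by the matrices `g` with `g s t = 0` unless `s ≤ t` and `j s ≤ j t`, as these
  preserve the shape of both factors (`exists_incidence_reduction`), and the rows `j s` of a slice
  matrix then solve a linear system (`exists_isSlice_of_factorization`).
* Conversely the slice coordinates are quotients of polynomials in the entries of the orbit point,
  with nowhere vanishing denominators: the columns and rows above are recovered by recursion along
  the values `j s` (`slice_factors_mem_regularFunctions`, `sliceCoord_mem_regularFunctions`).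

Maps with such coordinates are Zariski continuous (`zariskiOf_le`), so the orbit is homeomorphic to
the part of an affine space where certain coordinates do not vanish. The dimension of the latter is
the number of coordinates (`topologicalKrullDim_zariskiOf_coord_ne_zero`). Counting positions gives
the number of inversions of the permutation `i k j` plus `m (m + 1) / 2` (`card_slicePositions`),
and the number of inversions is the Coxeter length (`coxeterLength_eq_card_inversions`).
-/

open Topology
open scoped Matrix

/-! ### Zariski topologies and regular functions -/

/-- The Zariski topology on a type `X` pulled back along a system of coordinates
`φ : X → (σ → ℂ)`. -/
noncomputable abbrev zariskiOf {X σ : Type*} (φ : X → σ → ℂ) : TopologicalSpace X :=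
  TopologicalSpace.induced
    (fun x => MvPolynomial.pointToPoint (k := ℂ) (K := ℂ) (φ x)) inferInstance

theorem isClosed_zariskiOf_iff {X σ : Type*} (φ : X → σ → ℂ) (Z : Set X) :
    IsClosed[zariskiOf φ] Z ↔
      ∃ S : Set (MvPolynomial σ ℂ), Z = {x | ∀ f ∈ S, MvPolynomial.eval (φ x) f = 0} := by
  have key : ∀ S : Set (MvPolynomial σ ℂ),
      ((fun x => MvPolynomial.pointToPoint (k := ℂ) (K := ℂ) (φ x)) ⁻¹'
          PrimeSpectrum.zeroLocus S) = {x | ∀ f ∈ S, MvPolynomial.eval (φ x) f = 0} := by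
    intro S
    ext x
    simp [MvPolynomial.pointToPoint, PrimeSpectrum.mem_zeroLocus, Set.subset_def,
      MvPolynomial.mem_vanishingIdeal_iff, MvPolynomial.aeval_eq_eval]
  rw [zariskiOf, isClosed_induced_iff]
  constructor
  · rintro ⟨t, ht, rfl⟩
    obtain ⟨S, rfl⟩ := (PrimeSpectrum.isClosed_iff_zeroLocus t).1 ht
    exact ⟨S, key S⟩
  · rintro ⟨S, rfl⟩
    exact ⟨_, PrimeSpectrum.isClosed_zeroLocus S, key S⟩

/-- The functions `X → ℂ` which are quotients `P / Q` of polynomials in the coordinates `φ`,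
with `Q` vanishing nowhere on `X`. -/
def regularFunctions {X σ : Type*} (φ : X → σ → ℂ) : Subalgebra ℂ (X → ℂ) where
  carrier := {f | ∃ P Q : MvPolynomial σ ℂ, ∀ x, MvPolynomial.eval (φ x) Q ≠ 0 ∧
    f x = MvPolynomial.eval (φ x) P / MvPolynomial.eval (φ x) Q}
  mul_mem' := by
    rintro f g ⟨P, Q, h⟩ ⟨P', Q', h'⟩
    refine ⟨P * P', Q * Q', fun x => ⟨?_, ?_⟩⟩
    · simpa using ⟨(h x).1, (h' x).1⟩
    · rw [Pi.mul_apply, (h x).2, (h' x).2, map_mul, map_mul, div_mul_div_comm]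
  add_mem' := by
    rintro f g ⟨P, Q, h⟩ ⟨P', Q', h'⟩
    refine ⟨P * Q' + Q * P', Q * Q', fun x => ⟨?_, ?_⟩⟩
    · simpa using ⟨(h x).1, (h' x).1⟩
    · rw [Pi.add_apply, (h x).2, (h' x).2, div_add_div _ _ (h x).1 (h' x).1]
      simp
  algebraMap_mem' c := ⟨MvPolynomial.C c, 1, fun x => by simp⟩

section regularFunctions

variable {X σ : Type*} {φ : X → σ → ℂ}

theorem const_mem_regularFunctions (c : ℂ) : (fun _ : X => c) ∈ regularFunctions φ :=
  (regularFunctions φ).algebraMap_mem c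

theorem coord_mem_regularFunctions (s : σ) : (fun x => φ x s) ∈ regularFunctions φ :=
  ⟨MvPolynomial.X s, 1, fun x => by simp⟩

theorem div_mem_regularFunctions {f g : X → ℂ} (hf : f ∈ regularFunctions φ)
    (hg : g ∈ regularFunctions φ) (h0 : ∀ x, g x ≠ 0) :
    (fun x => f x / g x) ∈ regularFunctions φ := by
  obtain ⟨P, Q, h⟩ := hf
  obtain ⟨P', Q', h'⟩ := hg
  refine ⟨P * Q', Q * P', fun x => ⟨?_, ?_⟩⟩
  · have h1 := h0 x
    rw [(h' x).2] at h1
    rw [map_mul]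
    exact mul_ne_zero (h x).1 (div_ne_zero_iff.1 h1).1
  · simp only [(h x).2, (h' x).2, map_mul, div_div_div_eq]

theorem add_mem_regularFunctions {f g : X → ℂ} (hf : f ∈ regularFunctions φ)
    (hg : g ∈ regularFunctions φ) : (fun x => f x + g x) ∈ regularFunctions φ :=
  (regularFunctions φ).add_mem hf hg

theorem sub_mem_regularFunctions {f g : X → ℂ} (hf : f ∈ regularFunctions φ)
    (hg : g ∈ regularFunctions φ) : (fun x => f x - g x) ∈ regularFunctions φ :=
  (regularFunctions φ).sub_mem hf hg

theorem mul_mem_regularFunctions {f g : X → ℂ} (hf : f ∈ regularFunctions φ)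
    (hg : g ∈ regularFunctions φ) : (fun x => f x * g x) ∈ regularFunctions φ :=
  (regularFunctions φ).mul_mem hf hg

theorem sum_mem_regularFunctions {ι : Type*} (s : Finset ι) {f : ι → X → ℂ}
    (hf : ∀ a ∈ s, f a ∈ regularFunctions φ) :
    (fun x => ∑ a ∈ s, f a x) ∈ regularFunctions φ := by
  convert (regularFunctions φ).sum_mem hf using 1
  ext x
  simp

theorem prod_mem_regularFunctions {ι : Type*} (s : Finset ι) {f : ι → X → ℂ}
    (hf : ∀ a ∈ s, f a ∈ regularFunctions φ) :
    (fun x => ∏ a ∈ s, f a x) ∈ regularFunctions φ := by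
  convert (regularFunctions φ).prod_mem hf using 1
  ext x
  simp

theorem eval_mem_regularFunctions {τ : Type*} {ψ : X → τ → ℂ}
    (h : ∀ t, (fun x => ψ x t) ∈ regularFunctions φ) (f : MvPolynomial τ ℂ) :
    (fun x => MvPolynomial.eval (ψ x) f) ∈ regularFunctions φ := by
  induction f using MvPolynomial.induction_on with
  | C a => simpa using const_mem_regularFunctions a
  | add p q hp hq => simpa using add_mem_regularFunctions hp hq
  | mul_X p t hp => simpa using mul_mem_regularFunctions hp (h t)

/-- Coordinates that are regular in other coordinates define a coarser Zariski topology. -/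
theorem zariskiOf_le {τ : Type*} {ψ : X → τ → ℂ}
    (h : ∀ t, (fun x => ψ x t) ∈ regularFunctions φ) : zariskiOf φ ≤ zariskiOf ψ := by
  refine (@continuous_id_iff_le X (zariskiOf φ) (zariskiOf ψ)).1 ?_
  refine (@continuous_iff_isClosed X X (zariskiOf φ) (zariskiOf ψ) _).2 fun Z hZ => ?_
  obtain ⟨S, rfl⟩ := (isClosed_zariskiOf_iff ψ Z).1 hZ
  refine (isClosed_zariskiOf_iff φ _).2 ?_
  choose P Q hPQ using fun f => eval_mem_regularFunctions h f
  refine ⟨P '' S, ?_⟩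
  ext x
  have h1 : ∀ f, MvPolynomial.eval (ψ x) f = 0 ↔ MvPolynomial.eval (φ x) (P f) = 0 := by
    intro f
    have h2 := (hPQ f x).2
    simp only at h2
    simp [h2, (hPQ f x).1]
  simp [h1]

theorem det_mem_regularFunctions {κ : Type*} [Fintype κ] [DecidableEq κ]
    {M : X → Matrix κ κ ℂ} (h : ∀ a b, (fun x => M x a b) ∈ regularFunctions φ) :
    (fun x => (M x).det) ∈ regularFunctions φ := by
  simp only [Matrix.det_apply']
  exact sum_mem_regularFunctions _ fun s _ =>
    mul_mem_regularFunctions (const_mem_regularFunctions _)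
      (prod_mem_regularFunctions _ fun a _ => h _ _)

theorem inv_mem_regularFunctions {κ : Type*} [Fintype κ] [DecidableEq κ]
    {M : X → Matrix κ κ ℂ} (h : ∀ a b, (fun x => M x a b) ∈ regularFunctions φ)
    (h0 : ∀ x, (M x).det ≠ 0) (a b : κ) : (fun x => (M x)⁻¹ a b) ∈ regularFunctions φ := by
  have key : ∀ x, (M x)⁻¹ a b =
      ((M x).updateRow b (Pi.single a 1)).det / (M x).det := by
    intro x
    rw [Matrix.inv_def, Matrix.smul_apply, Matrix.adjugate_apply, Ring.inverse_eq_inv',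
      smul_eq_mul, div_eq_inv_mul]
  simp only [key]
  refine div_mem_regularFunctions (det_mem_regularFunctions fun r c => ?_)
    (det_mem_regularFunctions h) h0
  by_cases hr : r = b
  · subst hr
    simpa using const_mem_regularFunctions _
  · simpa [Matrix.updateRow_ne hr] using h r c

end regularFunctions

/-! ### Dimension of the complement of coordinate hyperplanes -/

/-- The part of affine space `ℂ^σ` where the coordinates in `T` do not vanish has dimension
`|σ|`: it embeds into the spectrum of the polynomial ring, and it contains the flag of affine
subspaces obtained by setting more and more coordinates equal to `1`. -/
theorem topologicalKrullDim_zariskiOf_coord_ne_zero {σ : Type*} [Fintype σ] (T : Set σ) :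
    @topologicalKrullDim {x : σ → ℂ // ∀ p ∈ T, x p ≠ 0} (zariskiOf Subtype.val) =
      Fintype.card σ := by
  classical
  set X := {x : σ → ℂ // ∀ p ∈ T, x p ≠ 0}
  let _ : TopologicalSpace X := zariskiOf Subtype.val
  refine le_antisymm ?_ ?_
  · have hind : IsInducing (fun x : X =>
        MvPolynomial.pointToPoint (k := ℂ) (K := ℂ) x.1) := ⟨rfl⟩
    refine hind.topologicalKrullDim_le.trans ?_
    rw [PrimeSpectrum.topologicalKrullDim_eq_ringKrullDim,
      MvPolynomial.ringKrullDim_of_isNoetherianRing, ringKrullDim_eq_zero_of_field]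
    simp
  · let e := Fintype.equivFin σ
    -- `Z l` has the first `l` coordinates free.
    let Z : ℕ → Set X := fun l => {x | ∀ p, l ≤ e p → x.1 p = 1}
    have hclosed : ∀ l, IsClosed (Z l) := by
      intro l
      refine (isClosed_zariskiOf_iff _ _).2
        ⟨(fun p => MvPolynomial.X p - 1) '' {p | l ≤ (e p : ℕ)}, ?_⟩
      ext x
      simp [Z, sub_eq_zero]
    have hirr : ∀ l, IsIrreducible (Z l) := by
      intro l
      refine ⟨⟨⟨fun _ => 1, by simp⟩, by simp [Z]⟩, ?_⟩
      rintro u v hu hv ⟨x, hxZ, hxu⟩ ⟨y, hyZ, hyv⟩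
      obtain ⟨Su, hSu⟩ := (isClosed_zariskiOf_iff _ _).1 hu.isClosed_compl
      obtain ⟨Sv, hSv⟩ := (isClosed_zariskiOf_iff _ _).1 hv.isClosed_compl
      have hx' : x ∉ uᶜ := by simpa using hxu
      have hy' : y ∉ vᶜ := by simpa using hyv
      simp only [hSu, hSv, Set.mem_ofPred_eq, not_forall, exists_prop] at hx' hy'
      obtain ⟨f, hf, hfx⟩ := hx'
      obtain ⟨g, hg, hgy⟩ := hy'
      -- Restrict everything to the line through `x` and `y`.
      let line : σ → Polynomial ℂ := fun p =>
        Polynomial.C (x.1 p) + Polynomial.X * Polynomial.C (y.1 p - x.1 p)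
      have heval : ∀ (t : ℂ) (q : MvPolynomial σ ℂ),
          (MvPolynomial.aeval line q).eval t =
            MvPolynomial.eval (fun p => x.1 p + t * (y.1 p - x.1 p)) q := by
        intro t q
        induction q using MvPolynomial.induction_on with
        | C a => simp
        | add p q hp hq => simp [hp, hq]
        | mul_X p s hp =>
          rw [map_mul, map_mul, Polynomial.eval_mul, hp]
          simp [line]
      have h0 : ∀ p, x.1 p + 0 * (y.1 p - x.1 p) = x.1 p := fun p => by ring
      have h1 : ∀ p, x.1 p + 1 * (y.1 p - x.1 p) = y.1 p := fun p => by ring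
      have hfne : MvPolynomial.aeval line f ≠ 0 := by
        intro h
        have h2 := heval 0 f
        simp only [h0, h, Polynomial.eval_zero] at h2
        exact hfx h2.symm
      have hgne : MvPolynomial.aeval line g ≠ 0 := by
        intro h
        have h2 := heval 1 g
        simp only [h1, h, Polynomial.eval_zero] at h2
        exact hgy h2.symm
      have hTne : ∏ p with p ∈ T, line p ≠ 0 := by
        refine Finset.prod_ne_zero_iff.2 fun p hp h => ?_
        refine x.2 p (by simpa using hp) ?_
        have h2 := congrArg (Polynomial.eval 0) h
        simpa [line] using h2
      obtain ⟨t, ht⟩ := Polynomial.exists_eval_ne_zero_of_natDegree_lt_card _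
        (mul_ne_zero (mul_ne_zero hfne hgne) hTne)
        ((Cardinal.natCast_lt_aleph0).trans_le (Cardinal.aleph0_le_mk ℂ))
      simp only [Polynomial.eval_mul, heval, Polynomial.eval_prod] at ht
      have ht1 := left_ne_zero_of_mul ht
      let z : X := ⟨fun p => x.1 p + t * (y.1 p - x.1 p), fun p hp => by
        have h2 := Finset.prod_ne_zero_iff.1 (right_ne_zero_of_mul ht) p (by simpa using hp)
        simpa [line] using h2⟩
      refine ⟨z, fun p hp => ?_, ?_, ?_⟩
      · simp [z, hxZ p hp, hyZ p hp]
      · by_contra hzu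
        have h2 : z ∈ uᶜ := hzu
        rw [hSu] at h2
        exact left_ne_zero_of_mul ht1 (h2 f hf)
      · by_contra hzv
        have h2 : z ∈ vᶜ := hzv
        rw [hSv] at h2
        exact right_ne_zero_of_mul ht1 (h2 g hg)
    let s : LTSeries (TopologicalSpace.IrreducibleCloseds X) :=
      { length := Fintype.card σ
        toFun := fun l => ⟨Z l, hirr l, hclosed l⟩
        step := by
          intro l
          change (_ : TopologicalSpace.IrreducibleCloseds X) < _
          refine SetLike.coe_ssubset_coe.1 ?_
          change Z l.castSucc ⊂ Z l.succ
          refine ⟨fun x hx p hp => hx p ?_, fun h => ?_⟩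
          · simp at hp ⊢
            omega
          · let x : X := ⟨fun p => if p = e.symm l then 2 else 1, fun p _ => by
              beta_reduce
              split_ifs <;> norm_num⟩
            have hx : x ∈ Z l.succ := by
              intro p hp
              have : p ≠ e.symm l := by
                rintro rfl
                simp at hp
              simp [x, this]
            have h2 := h hx (e.symm l) (by simp)
            simp [x] at h2 }
    exact Order.LTSeries.length_le_krullDim s

/-! ### Coxeter length and inversions -/

/-- The inversions of a permutation, as pairs of positions `p < q` with `π q < π p`. -/
def inversions {n : ℕ} (π : Equiv.Perm (Fin n)) : Finset (Fin n × Fin n) :=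
  Finset.univ.filter fun x => x.1 < x.2 ∧ π x.2 < π x.1

theorem mem_inversions {n : ℕ} {π : Equiv.Perm (Fin n)} {p q : Fin n} :
    (p, q) ∈ inversions π ↔ p < q ∧ π q < π p := by
  simp [inversions]

theorem inversions_one (n : ℕ) : inversions (1 : Equiv.Perm (Fin n)) = ∅ := by
  ext ⟨p, q⟩
  simpa [mem_inversions] using fun h => h.le

/-- A simple transposition preserves the order of every pair of positions but its own, so that
multiplication by it permutes the inversions different from that pair. -/
theorem card_inversions_mul_swap_erase {n : ℕ} (π : Equiv.Perm (Fin n)) {a b : Fin n}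
    (hab : (a : ℕ) + 1 = b) :
    ((inversions (π * Equiv.swap a b)).erase (a, b)).card = ((inversions π).erase (a, b)).card := by
  have hlt : ∀ p q : Fin n, p < q → (p, q) ≠ (a, b) →
      Equiv.swap a b p < Equiv.swap a b q ∧ (Equiv.swap a b p, Equiv.swap a b q) ≠ (a, b) := by
    intro p q hpq hne
    simp only [ne_eq, Prod.mk.injEq, Equiv.swap_apply_def] at hne ⊢
    split_ifs <;> grind
  refine Finset.card_bij' (fun x _ => (Equiv.swap a b x.1, Equiv.swap a b x.2))
    (fun x _ => (Equiv.swap a b x.1, Equiv.swap a b x.2)) ?_ ?_ ?_ ?_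
  · rintro ⟨p, q⟩ h
    simp only [Finset.mem_erase, mem_inversions, Equiv.Perm.mul_apply] at h ⊢
    exact ⟨(hlt p q h.2.1 h.1).2, (hlt p q h.2.1 h.1).1, h.2.2⟩
  · rintro ⟨p, q⟩ h
    simp only [Finset.mem_erase, mem_inversions, Equiv.Perm.mul_apply,
      Equiv.swap_apply_self] at h ⊢
    exact ⟨(hlt p q h.2.1 h.1).2, (hlt p q h.2.1 h.1).1, h.2.2⟩
  · simp
  · simp

theorem card_inversions_mul_swap_le {n : ℕ} (π : Equiv.Perm (Fin n)) {a b : Fin n}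
    (hab : (a : ℕ) + 1 = b) :
    (inversions (π * Equiv.swap a b)).card ≤ (inversions π).card + 1 := by
  have h1 := card_inversions_mul_swap_erase π hab
  have h2 := Finset.pred_card_le_card_erase (s := inversions (π * Equiv.swap a b)) (a := (a, b))
  have h3 := Finset.card_erase_le (s := inversions π) (a := (a, b))
  omega

theorem card_inversions_mul_swap_of_lt {n : ℕ} (π : Equiv.Perm (Fin n)) {a b : Fin n}
    (hab : (a : ℕ) + 1 = b) (h : π b < π a) :
    (inversions (π * Equiv.swap a b)).card + 1 = (inversions π).card := by
  have h1 := card_inversions_mul_swap_erase π hab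
  have hlt : a < b := by rw [Fin.lt_def]; omega
  have h2 : (a, b) ∈ inversions π := by exact mem_inversions.2 ⟨hlt, h⟩
  have h3 : (a, b) ∉ inversions (π * Equiv.swap a b) := by simp [mem_inversions, h.le]
  rw [Finset.erase_eq_of_notMem h3] at h1
  rw [h1, Finset.card_erase_add_one h2]

theorem exists_adjacent_descent {n : ℕ} (π : Equiv.Perm (Fin n)) (h : π ≠ 1) :
    ∃ a b : Fin n, (a : ℕ) + 1 = b ∧ π b < π a := by
  by_contra! hcon
  apply h
  cases n with
  | zero => exact Subsingleton.elim _ _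
  | succ n =>
    have hmono : StrictMono π := Fin.strictMono_iff_lt_succ.2 fun a =>
      lt_of_le_of_ne (hcon a.castSucc a.succ (by simp)) fun he =>
        (Fin.castSucc_lt_succ (i := a)).ne (π.injective he)
    exact Equiv.Perm.ext fun a => congrFun
      ((hmono.range_inj strictMono_id).1 (by simp [π.surjective.range_eq])) a

/-- Removing adjacent descents one by one gives a simple word as long as the number of
inversions. -/
theorem exists_isSimpleWord_length_eq {n : ℕ} (l : ℕ) (π : Equiv.Perm (Fin n))
    (h : (inversions π).card = l) : ∃ L, IsSimpleWord π L ∧ L.length = l := by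
  induction l generalizing π with
  | zero =>
    have : π = 1 := by
      by_contra hne
      obtain ⟨a, b, hab, hlt⟩ := exists_adjacent_descent π hne
      have := card_inversions_mul_swap_of_lt π hab hlt
      omega
    exact ⟨[], ⟨by simp, by simp [this]⟩, rfl⟩
  | succ l ih =>
    have hne : π ≠ 1 := by
      rintro rfl
      simp [inversions_one] at h
    obtain ⟨a, b, hab, hlt⟩ := exists_adjacent_descent π hne
    have h1 := card_inversions_mul_swap_of_lt π hab hlt
    obtain ⟨L, ⟨hL, hp⟩, hl⟩ := ih (π * Equiv.swap a b) (by omega)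
    refine ⟨L ++ [Equiv.swap a b], ⟨?_, by simp [hp]⟩, by simp [hl]⟩
    intro s hs
    rcases List.mem_append.1 hs with hs | hs
    · exact hL s hs
    · exact ⟨a, b, hab, by simpa using hs⟩

theorem card_inversions_prod_le_length {n : ℕ} (L : List (Equiv.Perm (Fin n)))
    (hL : ∀ s ∈ L, ∃ a b : Fin n, (a : ℕ) + 1 = b ∧ s = Equiv.swap a b) :
    (inversions L.prod).card ≤ L.length := by
  induction L using List.reverseRecOn with
  | nil =>
    simp [inversions_one]
  | append_singleton L s ih =>
    obtain ⟨a, b, hab, rfl⟩ := hL s (by simp)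
    have h1 := ih fun t ht => hL t (by simp [ht])
    have h2 := card_inversions_mul_swap_le L.prod hab
    simp only [List.prod_append, List.prod_singleton, List.length_append, List.length_singleton]
    omega

theorem coxeterLength_eq_card_inversions {n : ℕ} (π : Equiv.Perm (Fin n)) :
    coxeterLength π = (inversions π).card := by
  refine le_antisymm (Nat.sInf_le (exists_isSimpleWord_length_eq _ π rfl)) ?_
  refine le_csInf ⟨_, exists_isSimpleWord_length_eq _ π rfl⟩ ?_
  rintro l ⟨L, ⟨hL, rfl⟩, rfl⟩
  exact card_inversions_prod_le_length L hL

/-! ### Products of disjoint transpositions and permutation matrices -/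

theorem prod_swap_apply_of_notMem {α : Type*} [DecidableEq α] {m : ℕ} (i j : Fin m → α) (a : α)
    (hi : ∀ s, i s ≠ a) (hj : ∀ s, j s ≠ a) :
    (List.ofFn fun s => Equiv.swap (i s) (j s)).prod a = a := by
  induction m with
  | zero => simp
  | succ m ih =>
    rw [List.ofFn_succ, List.prod_cons, Equiv.Perm.mul_apply,
      ih (fun s => i s.succ) (fun s => j s.succ) (fun s => hi _) (fun s => hj _),
      Equiv.swap_apply_of_ne_of_ne (hi 0).symm (hj 0).symm]

theorem prod_swap_apply {α : Type*} [DecidableEq α] {m : ℕ} (i j : Fin m → α)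
    (h : Function.Injective (Sum.elim i j)) (s : Fin m) :
    (List.ofFn fun s => Equiv.swap (i s) (j s)).prod (i s) = j s ∧
      (List.ofFn fun s => Equiv.swap (i s) (j s)).prod (j s) = i s := by
  have hii : Function.Injective i := fun a b hab => Sum.inl_injective (h (by simpa using hab))
  have hjj : Function.Injective j := fun a b hab => Sum.inr_injective (h (by simpa using hab))
  have hne : ∀ a b, i a ≠ j b := fun a b hab => Sum.inl_ne_inr (h (by simpa using hab))
  induction m with
  | zero => exact s.elim0
  | succ m ih =>
    rw [List.ofFn_succ, List.prod_cons, Equiv.Perm.mul_apply, Equiv.Perm.mul_apply]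
    refine Fin.cases ?_ (fun t => ?_) s
    · rw [prod_swap_apply_of_notMem (fun s => i s.succ) (fun s => j s.succ) (i 0)
          (fun t => hii.ne (Fin.succ_ne_zero t)) (fun t => (hne _ _).symm),
        prod_swap_apply_of_notMem (fun s => i s.succ) (fun s => j s.succ) (j 0)
          (fun t => hne _ _) (fun t => hjj.ne (Fin.succ_ne_zero t))]
      simp
    · have htail : Function.Injective (Sum.elim (fun s : Fin m => i s.succ)
          fun s : Fin m => j s.succ) := by
        refine Function.Injective.sumElim (fun a b hab => ?_) (fun a b hab => ?_) fun a b => hne _ _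
        · exact Fin.succ_injective _ (hii hab)
        · exact Fin.succ_injective _ (hjj hab)
      have h1 := ih (fun s => i s.succ) (fun s => j s.succ) htail t
        (fun a b hab => Fin.succ_injective _ (hii hab))
        (fun a b hab => Fin.succ_injective _ (hjj hab)) (fun a b => hne _ _)
      rw [h1.1, h1.2]
      exact ⟨Equiv.swap_apply_of_ne_of_ne (hne _ _).symm (hjj.ne (Fin.succ_ne_zero t)),
        Equiv.swap_apply_of_ne_of_ne (hii.ne (Fin.succ_ne_zero t)) (hne _ _)⟩

theorem upperPart_prod_swap_apply {n m : ℕ} (i j : Fin m → Fin n) (hij : ∀ s, i s < j s)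
    (h : Function.Injective (Sum.elim i j)) (a b : Fin n) :
    upperPart (List.ofFn fun s => Equiv.swap (i s) (j s)).prod a b =
      if ∃ s, a = i s ∧ b = j s then 1 else 0 := by
  simp only [upperPart, permGL, Matrix.of_apply]
  by_cases hex : ∃ s, a = i s ∧ b = j s
  · obtain ⟨s, rfl, rfl⟩ := hex
    rw [if_neg (hij s).not_ge, if_pos (prod_swap_apply i j h s).2.symm, if_pos ⟨s, rfl, rfl⟩]
  · rw [if_neg hex]
    split_ifs with h1 h2
    · rfl
    · exfalso
      by_cases hbi : ∃ s, i s = b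
      · obtain ⟨s, rfl⟩ := hbi
        rw [(prod_swap_apply i j h s).1] at h2
        exact h1 (h2 ▸ (hij s).le)
      by_cases hbj : ∃ s, j s = b
      · obtain ⟨s, rfl⟩ := hbj
        rw [(prod_swap_apply i j h s).2] at h2
        exact hex ⟨s, h2, rfl⟩
      push Not at hbi hbj
      rw [prod_swap_apply_of_notMem i j b hbi hbj] at h2
      exact h1 h2.ge
    · rfl

theorem upperPart_minimalInvolution_apply {n m : ℕ} (hm : 2 * m ≤ n) (a b : Fin n) :
    upperPart (minimalInvolution n m hm) a b =
      if ∃ s : Fin m, (a : ℕ) = s ∧ (b : ℕ) = n - m + s then 1 else 0 := by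
  have key := upperPart_prod_swap_apply (n := n) (m := m) (fun s => ⟨s, by omega⟩)
    (fun s => ⟨n - m + s, by omega⟩) (fun s => by rw [Fin.lt_def]; simp only; omega) (by
      refine Function.Injective.sumElim (fun s t h => ?_) (fun s t h => ?_) (fun s t h => ?_)
      all_goals simp only [Fin.ext_iff] at h ⊢
      all_goals omega) a b
  simp only [Fin.ext_iff] at key
  exact key

theorem permGL_conj_apply {n : ℕ} (π : Equiv.Perm (Fin n)) (N : Matrix (Fin n) (Fin n) ℂ)
    (a b : Fin n) :
    ((permGL π : Matrix (Fin n) (Fin n) ℂ) * N *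
      ((permGL π)⁻¹ : GL (Fin n) ℂ)) a b = N (π.symm a) (π.symm b) := by
  have hinv : ∀ c d, (((permGL π)⁻¹ : GL (Fin n) ℂ) : Matrix (Fin n) (Fin n) ℂ) c d =
      if π c = d then 1 else 0 := fun c d => rfl
  have hval : ∀ c d, (permGL π : Matrix (Fin n) (Fin n) ℂ) c d = if c = π d then 1 else 0 :=
    fun c d => rfl
  simp only [Matrix.mul_apply, hinv, hval, ← Equiv.symm_apply_eq, ite_mul, one_mul, zero_mul,
    Finset.sum_ite_eq, Finset.mem_univ, if_true, mul_ite, mul_one, mul_zero]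
  simp only [← Equiv.eq_symm_apply, Finset.sum_ite_eq', Finset.mem_univ, if_true]

/-- A permutation with prescribed one-line notation, cut into three blocks. -/
theorem exists_perm_ofFn_eq_append {n m : ℕ} (hm : 2 * m ≤ n) (i j : Fin m → Fin n)
    (k : Fin (n - 2 * m) → Fin n) (hij : Function.Injective (Sum.elim i j))
    (hk : Function.Injective k) (hki : ∀ l s, k l ≠ i s) (hkj : ∀ l s, k l ≠ j s) :
    ∃ π : Equiv.Perm (Fin n),
      List.ofFn (fun a => π a) = List.ofFn i ++ List.ofFn k ++ List.ofFn j ∧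
      (∀ s : Fin m, π ⟨s, by omega⟩ = i s) ∧
      (∀ l : Fin (n - 2 * m), π ⟨m + l, by omega⟩ = k l) ∧
      ∀ s : Fin m, π ⟨n - m + s, by omega⟩ = j s := by
  have hii : Function.Injective i := fun a b hab => Sum.inl_injective (hij (by simpa using hab))
  have hjj : Function.Injective j := fun a b hab => Sum.inr_injective (hij (by simpa using hab))
  have hne : ∀ a b, i a ≠ j b := fun a b hab => Sum.inl_ne_inr (hij (by simpa using hab))
  let f : Fin n → Fin n := fun a =>
    if h : (a : ℕ) < m then i ⟨a, h⟩
    else if h' : (a : ℕ) < n - m then k ⟨a - m, by omega⟩ else j ⟨a - (n - m), by omega⟩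
  have hf : Function.Injective f := by
    intro a b hab
    simp only [f] at hab
    split_ifs at hab
    · have := hii hab
      simpa [Fin.ext_iff] using this
    · exact absurd hab.symm (hki _ _)
    · exact absurd hab (hne _ _)
    · exact absurd hab (hki _ _)
    · have := hk hab
      simp only [Fin.mk.injEq] at this
      exact Fin.ext (by omega)
    · exact absurd hab (hkj _ _)
    · exact absurd hab.symm (hne _ _)
    · exact absurd hab.symm (hkj _ _)
    · have := hjj hab
      simp only [Fin.mk.injEq] at this
      exact Fin.ext (by omega)
  refine ⟨Equiv.ofBijective f (Finite.injective_iff_bijective.1 hf), ?_, ?_, ?_, ?_⟩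
  · refine List.ext_getElem (by simp; omega) fun a h1 h2 => ?_
    simp only [List.getElem_ofFn, Equiv.ofBijective_apply, List.getElem_append,
      List.length_append, List.length_ofFn, f]
    split_ifs with h3 h4 h5 h6
    · rfl
    · omega
    · rfl
    · omega
    · omega
    · congr 2
      omega
  · intro s
    simp [f]
  · intro l
    have h1 : m + (l : ℕ) < n - m := by omega
    simp [f, h1]
  · intro s
    have h1 : ¬ n - m + (s : ℕ) < m := by omega
    simp [f, h1]

/-! ### Free positions of the slice -/

/-- The positions of the free entries in the slice of the Borel subgroup which parametrizes the
orbit of the partial permutation matrix with ones in the positions `(i s, j s)`: the columns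
indexed by `i` and the rows indexed by `j`, except for those entries `(i s, i t)` that the
stabilizer permits to be normalized. -/
def slicePositions {n m : ℕ} (i j : Fin m → Fin n) : Finset (Fin n × Fin n) :=
  Finset.univ.filter fun x => x.1 ≤ x.2 ∧ ((∃ t, i t = x.2) ∨ ∃ s, j s = x.1) ∧
    ∀ s t, i s = x.1 → i t = x.2 → s < t ∧ j t < j s

theorem mem_slicePositions {n m : ℕ} {i j : Fin m → Fin n} {r c : Fin n} :
    (r, c) ∈ slicePositions i j ↔ r ≤ c ∧ ((∃ t, i t = c) ∨ ∃ s, j s = r) ∧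
      ∀ s t, i s = r → i t = c → s < t ∧ j t < j s := by
  simp [slicePositions]

theorem card_filter_le_of_injective {α : Type*} [LinearOrder α] {m : ℕ} {j : Fin m → α}
    (hj : Function.Injective j) :
    (Finset.univ.filter fun x : Fin m × Fin m => j x.1 ≤ j x.2).card = m * (m + 1) / 2 := by
  set A := Finset.univ.filter fun x : Fin m × Fin m => j x.1 ≤ j x.2
  set B := Finset.univ.filter fun x : Fin m × Fin m => j x.2 ≤ j x.1
  have hAB : A.card = B.card :=
    Finset.card_bij' (fun x _ => x.swap) (fun x _ => x.swap) (by simp [A, B]) (by simp [A, B])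
      (by simp) (by simp)
  have hU : (A ∪ B).card = m * m := by
    have : A ∪ B = Finset.univ := by
      ext x
      simpa [A, B] using le_total _ _
    simp [this]
  have hI : (A ∩ B).card = m := by
    have : A ∩ B = Finset.univ.image fun s : Fin m => (s, s) := by
      ext ⟨s, t⟩
      simp only [A, B, Finset.mem_inter, Finset.mem_filter, Finset.mem_univ, true_and,
        Finset.mem_image, Prod.mk.injEq, exists_eq_left]
      exact ⟨fun h => hj (le_antisymm h.1 h.2), fun h => by simp [h]⟩
    rw [this, Finset.card_image_of_injective _ fun s t h => by simpa using h]
    simp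
  have := Finset.card_union_add_card_inter A B
  rw [hU, hI, ← hAB] at this
  have h2 : m * (m + 1) = 2 * A.card := by linarith
  omega

/-- The free positions of the slice are counted by the inversions of the permutation with one-line
notation `i k j`, together with the pairs `j s ≤ j t`. Read an inversion as a pair of values
`x < y` such that `y` stands to the left of `x`. Unless both values lie in the block `j`, the pair
`(x, y)` is itself a free position; if they are `j s` and `j t`, it stands for the free position
`(i t, i s)`. The remaining free positions are the `(j s, j t)` with `j s ≤ j t`. -/
theorem card_slicePositions {n m : ℕ} (hm : 2 * m ≤ n) {i j : Fin m → Fin n}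
    {k : Fin (n - 2 * m) → Fin n} (hi : StrictMono i) (hij : Function.Injective (Sum.elim i j))
    (hk : StrictMono k) (π : Equiv.Perm (Fin n)) (hπi : ∀ s : Fin m, π ⟨s, by omega⟩ = i s)
    (hπk : ∀ l : Fin (n - 2 * m), π ⟨m + l, by omega⟩ = k l)
    (hπj : ∀ s : Fin m, π ⟨n - m + s, by omega⟩ = j s) :
    (slicePositions i j).card = (inversions π).card + m * (m + 1) / 2 := by
  have hjj : Function.Injective j := fun a b hab => Sum.inr_injective (hij (by simpa using hab))
  have hne : ∀ a b, i a ≠ j b := fun a b hab => Sum.inl_ne_inr (hij (by simpa using hab))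
  have hcases : ∀ x : Fin n, (∃ s, i s = x) ∨ (∃ l, k l = x) ∨ ∃ s, j s = x := by
    intro x
    obtain ⟨p, rfl⟩ := π.surjective x
    by_cases h1 : (p : ℕ) < m
    · exact Or.inl ⟨⟨p, h1⟩, (hπi ⟨p, h1⟩).symm⟩
    by_cases h2 : (p : ℕ) < n - m
    · refine Or.inr (Or.inl ⟨⟨p - m, by omega⟩, ?_⟩)
      rw [← hπk]
      congr 1
      ext
      simp only
      omega
    · refine Or.inr (Or.inr ⟨⟨p - (n - m), by omega⟩, ?_⟩)
      rw [← hπj]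
      congr 1
      ext
      simp only
      omega
  have hki : ∀ l s, k l ≠ i s := by
    intro l s h
    rw [← hπk, ← hπi] at h
    have := congrArg Fin.val (π.injective h)
    simp only at this
    omega
  have hkj : ∀ l s, k l ≠ j s := by
    intro l s h
    rw [← hπk, ← hπj] at h
    have := congrArg Fin.val (π.injective h)
    simp only at this
    omega
  have hρi : ∀ s, (π.symm (i s) : ℕ) = s := fun s => by simp [← hπi]
  have hρk : ∀ l, (π.symm (k l) : ℕ) = m + l := fun s => by simp [← hπk]
  have hρj : ∀ s, (π.symm (j s) : ℕ) = n - m + s := fun s => by simp [← hπj]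
  -- `C` consists of the inversions between values of different blocks, and `D` indexes the
  -- inversions within the block `j`, the only block that has any.
  set C : Finset (Fin n × Fin n) := Finset.univ.filter fun x => x.1 < x.2 ∧
    (((∃ t, i t = x.2) ∧ ¬ ∃ s, i s = x.1) ∨ ((∃ s, j s = x.1) ∧ ¬ ∃ t, j t = x.2))
  set D : Finset (Fin m × Fin m) := Finset.univ.filter fun x => x.2 < x.1 ∧ j x.1 < j x.2
  set E : Finset (Fin m × Fin m) := Finset.univ.filter fun x => j x.1 ≤ j x.2
  have hii := hi.injective
  -- `C ∪ image of D` is the set of inversions, written as pairs of values.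
  have hCD : ∀ x y, (x, y) ∈ (C ∪ D.image fun x => (j x.1, j x.2)) ↔
      x < y ∧ π.symm y < π.symm x := by
    intro x y
    simp only [Finset.mem_union, Finset.mem_filter, Finset.mem_univ, true_and, Finset.mem_image,
      Prod.exists, Prod.mk.injEq, C, D]
    rcases hcases x with ⟨s, rfl⟩ | ⟨s, rfl⟩ | ⟨s, rfl⟩ <;>
      rcases hcases y with ⟨t, rfl⟩ | ⟨t, rfl⟩ | ⟨t, rfl⟩ <;>
      simp [Fin.lt_def (a := π.symm _), hρi, hρk, hρj, hne, fun a b => (hne a b).symm,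
        fun a b => (hki a b).symm, fun a b => (hkj a b).symm, hii.eq_iff, hjj.eq_iff,
        hi.lt_iff_lt, hk.lt_iff_lt]
    all_goals first | exact le_of_lt | exact and_comm | (intros; omega)
  have hinv : (inversions π).card = (C ∪ D.image fun x => (j x.1, j x.2)).card := by
    refine Finset.card_bij' (fun x _ => (π x.2, π x.1)) (fun x _ => (π.symm x.2, π.symm x.1))
      ?_ ?_ (by simp) (by simp)
    · rintro ⟨p, q⟩ h
      rw [mem_inversions] at h
      exact (hCD _ _).2 ⟨h.2, by simpa using h.1⟩
    · rintro ⟨p, q⟩ h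
      rw [hCD] at h
      exact mem_inversions.2 ⟨h.2, by simpa using h.1⟩
  have hsl : slicePositions i j =
      C ∪ (D.image fun x => (i x.2, i x.1)) ∪ E.image fun x => (j x.1, j x.2) := by
    ext ⟨x, y⟩
    simp only [mem_slicePositions, Finset.mem_union, Finset.mem_filter, Finset.mem_univ, true_and,
      Finset.mem_image, Prod.exists, Prod.mk.injEq, C, D, E]
    rcases hcases x with ⟨s, rfl⟩ | ⟨s, rfl⟩ | ⟨s, rfl⟩ <;>
      rcases hcases y with ⟨t, rfl⟩ | ⟨t, rfl⟩ | ⟨t, rfl⟩ <;>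
      simp [hne, fun a b => (hne a b).symm, fun a b => (hki a b).symm,
        fun a b => (hkj a b).symm, hii.eq_iff, hjj.eq_iff,
        hi.le_iff_le]
    · exact fun h _ => h.le
    · exact ⟨fun h => lt_of_le_of_ne h (hki _ _), le_of_lt⟩
    · exact ⟨fun h => lt_of_le_of_ne h (hne _ _).symm, le_of_lt⟩
    · exact ⟨fun h => lt_of_le_of_ne h (hkj _ _).symm, le_of_lt⟩
  have hd1 : Disjoint C (D.image fun x => (j x.1, j x.2)) := by
    refine Finset.disjoint_left.2 fun x hx h => ?_
    obtain ⟨y, -, rfl⟩ := Finset.mem_image.1 h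
    simp [C, hne, hjj.eq_iff] at hx
  have hd2 : Disjoint C (D.image fun x => (i x.2, i x.1)) := by
    refine Finset.disjoint_left.2 fun x hx h => ?_
    obtain ⟨y, -, rfl⟩ := Finset.mem_image.1 h
    simp [C, fun a b => (hne a b).symm, hii.eq_iff] at hx
  have hd3 : Disjoint (C ∪ (D.image fun x => (i x.2, i x.1)))
      (E.image fun x => (j x.1, j x.2)) := by
    refine Finset.disjoint_left.2 fun x hx h => ?_
    obtain ⟨y, -, rfl⟩ := Finset.mem_image.1 h
    simp [C, hne, hjj.eq_iff] at hx
  rw [hsl, hinv, Finset.card_union_of_disjoint hd3, Finset.card_union_of_disjoint hd2,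
    Finset.card_union_of_disjoint hd1, Finset.card_image_of_injective,
    Finset.card_image_of_injective, Finset.card_image_of_injective,
    card_filter_le_of_injective hjj]
  · rintro ⟨a, b⟩ ⟨c, d⟩ h
    simpa [hjj.eq_iff] using h
  · rintro ⟨a, b⟩ ⟨c, d⟩ h
    simpa [hjj.eq_iff] using h
  · rintro ⟨a, b⟩ ⟨c, d⟩ h
    simpa [hi.injective.eq_iff, and_comm] using h

/-! ### Triangular matrices -/

theorem det_ne_zero_of_blockTriangular {α β : Type*} [Fintype α] [DecidableEq α] [LinearOrder β]
    {f : α → β} (hf : Function.Injective f) {M : Matrix α α ℂ} (hM : M.BlockTriangular f)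
    (hd : ∀ a, M a a ≠ 0) : M.det ≠ 0 := by
  let _ : LinearOrder α := LinearOrder.lift' f hf
  have h : M.BlockTriangular id := fun a b hab => hM hab
  rw [Matrix.det_of_isUpperTriangular h]
  exact Finset.prod_ne_zero_iff.2 fun a _ => hd a

theorem inv_blockTriangular {α β : Type*} [Fintype α] [DecidableEq α] [LinearOrder β]
    {f : α → β} {M : Matrix α α ℂ} (hM : M.BlockTriangular f) (hd : M.det ≠ 0) :
    M⁻¹.BlockTriangular f := by
  have : Invertible M := Matrix.invertibleOfIsUnitDet M (isUnit_iff_ne_zero.2 hd)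
  exact Matrix.blockTriangular_inv_of_blockTriangular hM

theorem mul_apply_self_of_blockTriangular {α β : Type*} [Fintype α] [LinearOrder β]
    {f : α → β} (hf : Function.Injective f) {M N : Matrix α α ℂ} (hM : M.BlockTriangular f)
    (hN : N.BlockTriangular f) (a : α) : (M * N) a a = M a a * N a a := by
  rw [Matrix.mul_apply]
  refine Finset.sum_eq_single a (fun b _ hb => ?_) (by simp)
  rcases lt_or_gt_of_ne (hf.ne hb) with h | h
  · rw [hM h, zero_mul]
  · rw [hN h, mul_zero]

theorem inv_apply_self_ne_zero_of_blockTriangular {α β : Type*} [Fintype α] [DecidableEq α]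
    [LinearOrder β] {f : α → β} (hf : Function.Injective f) {M : Matrix α α ℂ}
    (hM : M.BlockTriangular f) (hd : M.det ≠ 0) (a : α) : M⁻¹ a a ≠ 0 := by
  have h := mul_apply_self_of_blockTriangular hf hM (inv_blockTriangular hM hd) a
  rw [Matrix.mul_nonsing_inv _ (isUnit_iff_ne_zero.2 hd), Matrix.one_apply_eq] at h
  exact right_ne_zero_of_mul (h ▸ one_ne_zero)

/-! ### The slice of the Borel subgroup -/

/-- The partial permutation matrix with ones in the positions `(i s, j s)`. -/
def pairMatrix {n m : ℕ} (i j : Fin m → Fin n) : Matrix (Fin n) (Fin n) ℂ :=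
  (1 : Matrix (Fin n) (Fin n) ℂ).submatrix id i * (1 : Matrix (Fin n) (Fin n) ℂ).submatrix j id

theorem mul_one_submatrix_eq_submatrix {n m : ℕ} (i : Fin m → Fin n)
    (b : Matrix (Fin n) (Fin n) ℂ) :
    b * (1 : Matrix (Fin n) (Fin n) ℂ).submatrix id i = b.submatrix id i := by
  ext a s
  simp [Matrix.mul_apply, Matrix.one_apply]

theorem one_submatrix_mul_eq_submatrix {n m : ℕ} (j : Fin m → Fin n)
    (b : Matrix (Fin n) (Fin n) ℂ) :
    (1 : Matrix (Fin n) (Fin n) ℂ).submatrix j id * b = b.submatrix j id := by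
  ext a s
  simp [Matrix.mul_apply, Matrix.one_apply]

theorem mul_pairMatrix_mul {n m : ℕ} (i j : Fin m → Fin n) (b c : Matrix (Fin n) (Fin n) ℂ) :
    b * pairMatrix i j * c = b.submatrix id i * c.submatrix j id := by
  rw [pairMatrix, ← Matrix.mul_assoc, mul_one_submatrix_eq_submatrix,
    Matrix.mul_assoc, one_submatrix_mul_eq_submatrix]

theorem pairMatrix_apply {n m : ℕ} {i j : Fin m → Fin n} (hi : Function.Injective i)
    (a b : Fin n) : pairMatrix i j a b = if ∃ s, a = i s ∧ b = j s then 1 else 0 := by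
  simp only [pairMatrix, Matrix.mul_apply, Matrix.submatrix_apply, id_eq, Matrix.one_apply]
  split_ifs with h
  · obtain ⟨s, rfl, rfl⟩ := h
    rw [Finset.sum_eq_single s]
    · simp
    · intro t _ ht
      simp [hi.ne ht.symm]
    · simp
  · refine Finset.sum_eq_zero fun s _ => ?_
    by_cases h1 : a = i s
    · have h2 : j s ≠ b := fun h2 => h ⟨s, h1, h2.symm⟩
      simp [h2]
    · simp [h1]

theorem mul_pairMatrix_mul_apply {n m : ℕ} (i j : Fin m → Fin n) (b c : Matrix (Fin n) (Fin n) ℂ)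
    (r d : Fin n) : (b * pairMatrix i j * c) r d = ∑ s, b r (i s) * c (j s) d := by
  rw [mul_pairMatrix_mul, Matrix.mul_apply]
  rfl

/-- The invertible upper triangular matrices which differ from the identity only in columns
indexed by `i` and in rows indexed by `j`, normalized in the rows indexed by `i`. They represent
the Borel subgroup modulo the stabilizer of `pairMatrix i j`. -/
structure IsSlice {n m : ℕ} (i j : Fin m → Fin n) (b : Matrix (Fin n) (Fin n) ℂ) : Prop where
  upper : b.BlockTriangular id
  diag_ne_zero : ∀ r, b r r ≠ 0
  apply_self : ∀ s, b (i s) (i s) = 1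
  apply_eq_zero : ∀ s t, s < t → j s < j t → b (i s) (i t) = 0
  apply_other : ∀ r c, (∀ s, j s ≠ r) → (∀ t, i t ≠ c) → b r c = if r = c then 1 else 0

theorem IsSlice.det_ne_zero {n m : ℕ} {i j : Fin m → Fin n} {b : Matrix (Fin n) (Fin n) ℂ}
    (h : IsSlice i j b) : b.det ≠ 0 :=
  det_ne_zero_of_blockTriangular Function.injective_id h.upper h.diag_ne_zero

/-- The coordinate space of the slice: the diagonal coordinates are required to be nonzero. -/
abbrev SliceCoord {n m : ℕ} (i j : Fin m → Fin n) :=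
  {x : slicePositions i j → ℂ // ∀ p ∈ {p : slicePositions i j | p.1.1 = p.1.2}, x p ≠ 0}

/-- The matrix of the slice with given coordinates. -/
def sliceMatrix {n m : ℕ} {i j : Fin m → Fin n} (x : SliceCoord i j) :
    Matrix (Fin n) (Fin n) ℂ :=
  Matrix.of fun r c => if h : (r, c) ∈ slicePositions i j then x.1 ⟨(r, c), h⟩
    else if r = c then 1 else 0

theorem sliceMatrix_of_mem {n m : ℕ} {i j : Fin m → Fin n} (x : SliceCoord i j) {r c : Fin n}
    (h : (r, c) ∈ slicePositions i j) : sliceMatrix x r c = x.1 ⟨(r, c), h⟩ :=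
  dif_pos h

theorem sliceMatrix_of_notMem {n m : ℕ} {i j : Fin m → Fin n} (x : SliceCoord i j) {r c : Fin n}
    (h : (r, c) ∉ slicePositions i j) : sliceMatrix x r c = if r = c then 1 else 0 :=
  dif_neg h

theorem isSlice_sliceMatrix {n m : ℕ} {i j : Fin m → Fin n} (hi : Function.Injective i)
    (x : SliceCoord i j) :
    IsSlice i j (sliceMatrix x) where
  upper r c h := by
    rw [sliceMatrix_of_notMem, if_neg (by rintro rfl; exact lt_irrefl _ h)]
    exact fun h' => h.not_ge (mem_slicePositions.1 h').1
  diag_ne_zero r := by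
    by_cases h : (r, r) ∈ slicePositions i j
    · rw [sliceMatrix_of_mem x h]
      exact x.2 _ rfl
    · simp [sliceMatrix_of_notMem x h]
  apply_self s := by
    rw [sliceMatrix_of_notMem, if_pos rfl]
    exact fun h => lt_irrefl _ ((mem_slicePositions.1 h).2.2 s s rfl rfl).1
  apply_eq_zero s t hst hj := by
    rw [sliceMatrix_of_notMem, if_neg (hi.ne hst.ne)]
    exact fun h => hj.not_gt ((mem_slicePositions.1 h).2.2 s t rfl rfl).2
  apply_other r c hr hc := by
    rw [sliceMatrix_of_notMem]
    rintro h
    rcases (mem_slicePositions.1 h).2.1 with ⟨t, ht⟩ | ⟨s, hs⟩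
    · exact hc t ht
    · exact hr s hs

theorem IsSlice.exists_sliceMatrix_eq {n m : ℕ} {i j : Fin m → Fin n} (hi : StrictMono i)
    (hj : Function.Injective j) {b : Matrix (Fin n) (Fin n) ℂ} (hb : IsSlice i j b) :
    ∃ x : SliceCoord i j, sliceMatrix x = b := by
  refine ⟨⟨fun p => b p.1.1 p.1.2, ?_⟩, ?_⟩
  · rintro ⟨⟨r, c⟩, h⟩ hrc
    obtain rfl : r = c := hrc
    exact hb.diag_ne_zero r
  · ext r c
    by_cases h : (r, c) ∈ slicePositions i j
    · rw [sliceMatrix_of_mem _ h]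
    rw [sliceMatrix_of_notMem _ h]
    rcases lt_or_ge c r with hcr | hrc
    · rw [hb.upper hcr, if_neg hcr.ne']
    by_cases h1 : (∃ t, i t = c) ∨ ∃ s, j s = r
    · have h2 : ∃ s t, i s = r ∧ i t = c ∧ (s < t → j s ≤ j t) := by
        by_contra! hcon
        refine h (mem_slicePositions.2 ⟨hrc, h1, fun s t hs ht => hcon s t hs ht⟩)
      obtain ⟨s, t, rfl, rfl, hst⟩ := h2
      rcases (hi.le_iff_le.1 hrc).eq_or_lt with rfl | hlt
      · rw [hb.apply_self, if_pos rfl]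
      · rw [hb.apply_eq_zero s t hlt ((hst hlt).lt_of_ne (hj.ne hlt.ne)),
          if_neg (hi hlt).ne]
    · push Not at h1
      exact (hb.apply_other r c h1.2 h1.1).symm

/-- Outside the columns indexed by `i`, a product `V * b` only sees the rows of `b` indexed
by `j` and the diagonal of `b`. -/
theorem mul_apply_of_apply_other {n m : ℕ} {i j : Fin m → Fin n} (hj : Function.Injective j)
    (V : Matrix (Fin m) (Fin n) ℂ) (b : Matrix (Fin n) (Fin n) ℂ)
    (hb : ∀ r c, (∀ s, j s ≠ r) → (∀ t, i t ≠ c) → b r c = if r = c then 1 else 0)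
    (s : Fin m) {c : Fin n} (hc : ∀ t, i t ≠ c) :
    (V * b) s c = (V.submatrix id j * b.submatrix j id) s c +
      if ∃ t, j t = c then 0 else V s c := by
  rw [Matrix.mul_apply, ← Finset.sum_filter_add_sum_filter_not Finset.univ
    (fun r => r ∈ Finset.univ.image j)]
  congr 1
  · rw [Finset.filter_mem_eq_inter, Finset.univ_inter, Finset.sum_image fun s _ t _ h => hj h]
    rfl
  · have h1 : ∀ r ∈ Finset.univ.filter (fun r => r ∉ Finset.univ.image j),
        V s r * b r c = if r = c then V s c else 0 := by
      intro r hr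
      rw [hb r c (by simpa using hr) hc]
      by_cases hrc : r = c <;> simp [hrc]
    rw [Finset.sum_congr rfl h1, Finset.sum_ite_eq']
    by_cases h : ∃ t, j t = c <;> simp [h]

/-- The right hand side of the linear system satisfied by the rows indexed by `j` of a slice
matrix `b` when `V` consists of the rows indexed by `j` of `b⁻¹`. -/
def rowSystem {n m : ℕ} (j : Fin m → Fin n) (V : Matrix (Fin m) (Fin n) ℂ) :
    Matrix (Fin m) (Fin n) ℂ :=
  Matrix.of fun s c => (1 : Matrix (Fin n) (Fin n) ℂ) (j s) c - if ∃ t, j t = c then 0 else V s c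

theorem apply_eq_inv_mul_rowSystem {n m : ℕ} {i j : Fin m → Fin n} (hj : Function.Injective j)
    {V : Matrix (Fin m) (Fin n) ℂ} {b : Matrix (Fin n) (Fin n) ℂ}
    (hb : ∀ r c, (∀ s, j s ≠ r) → (∀ t, i t ≠ c) → b r c = if r = c then 1 else 0)
    (hV : (V.submatrix id j).det ≠ 0)
    (hVb : V * b = (1 : Matrix (Fin n) (Fin n) ℂ).submatrix j id)
    (s : Fin m) {c : Fin n} (hc : ∀ t, i t ≠ c) :
    b (j s) c = ((V.submatrix id j)⁻¹ * rowSystem j V) s c := by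
  have h1 : ∀ t, (V.submatrix id j * b.submatrix j id) t c = rowSystem j V t c := by
    intro t
    have h2 := mul_apply_of_apply_other hj V b hb t hc
    rw [hVb] at h2
    simp only [rowSystem, Matrix.of_apply]
    rw [eq_sub_iff_add_eq, ← h2]
    rfl
  have h3 : ((V.submatrix id j)⁻¹ * (V.submatrix id j * b.submatrix j id)) s c = b (j s) c := by
    rw [← Matrix.mul_assoc, Matrix.nonsing_inv_mul _ (isUnit_iff_ne_zero.2 hV), Matrix.one_mul]
    rfl
  rw [← h3, Matrix.mul_apply, Matrix.mul_apply]
  exact Finset.sum_congr rfl fun t _ => by rw [h1]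

/-! ### Surjectivity of the orbit map on the slice -/

/-- Column reduction by matrices in the incidence algebra of the partial order
`s ≤ t ∧ j s ≤ j t`: the `t`-th column of the reducing matrix is the solution of the triangular
linear system on the lower set of `t`. -/
theorem exists_incidence_reduction {m : ℕ} {α : Type*} [LinearOrder α] (j : Fin m → α)
    {M : Matrix (Fin m) (Fin m) ℂ} (hM : M.BlockTriangular id) (hd : ∀ s, M s s ≠ 0) :
    ∃ g : Matrix (Fin m) (Fin m) ℂ, g.BlockTriangular id ∧ g.BlockTriangular j ∧
      ∀ s t, s ≤ t → j s ≤ j t → (M * g) s t = if s = t then 1 else 0 := by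
  let R : Fin m → Type := fun t => {s : Fin m // s ≤ t ∧ j s ≤ j t}
  let A : ∀ t, Matrix (R t) (R t) ℂ := fun t => M.submatrix Subtype.val Subtype.val
  have hA : ∀ t, (A t).det ≠ 0 := fun t =>
    det_ne_zero_of_blockTriangular (f := Subtype.val) Subtype.val_injective
      (fun a b hab => hM hab) (fun a => hd a.1)
  let y : ∀ t, R t → ℂ := fun t => (A t)⁻¹ *ᵥ Pi.single ⟨t, le_rfl, le_rfl⟩ 1
  have hy : ∀ t, A t *ᵥ y t = Pi.single ⟨t, le_rfl, le_rfl⟩ 1 := by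
    intro t
    rw [Matrix.mulVec_mulVec, Matrix.mul_nonsing_inv _ (isUnit_iff_ne_zero.2 (hA t)),
      Matrix.one_mulVec]
  let g : Matrix (Fin m) (Fin m) ℂ :=
    Matrix.of fun s t => if h : s ≤ t ∧ j s ≤ j t then y t ⟨s, h⟩ else 0
  refine ⟨g, fun s t h => dif_neg fun h' => h.not_ge h'.1, fun s t h => dif_neg fun h' =>
    h.not_ge h'.2, fun s t hst hjst => ?_⟩
  have h1 : (M * g) s t = (A t *ᵥ y t) ⟨s, hst, hjst⟩ := by
    rw [Matrix.mul_apply, ← Finset.sum_filter_add_sum_filter_not Finset.univ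
      (fun r => r ≤ t ∧ j r ≤ j t)]
    rw [Finset.sum_eq_zero (s := Finset.univ.filter fun r => ¬ (r ≤ t ∧ j r ≤ j t)), add_zero]
    · rw [Finset.sum_subtype (p := fun r => r ≤ t ∧ j r ≤ j t) _ (by simp)]
      refine Finset.sum_congr rfl fun r _ => ?_
      simp only [g, Matrix.of_apply, dif_pos r.2]
      rfl
    · intro r hr
      simp only [g, Matrix.of_apply, dif_neg (Finset.mem_filter.1 hr).2, mul_zero]
  rw [h1, hy]
  by_cases h : s = t
  · subst h
    simp
  · rw [if_neg h, Pi.single_eq_of_ne]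
    exact fun h' => h (congrArg Subtype.val h')

/-- A rank factorization `U * V` of square zero whose columns and rows have the shape of those of
a slice matrix and its inverse comes from the slice. -/
theorem exists_isSlice_of_factorization {n m : ℕ} {i j : Fin m → Fin n}
    (hi : Function.Injective i) (hj : Function.Injective j) (hne : ∀ s t, i s ≠ j t)
    {U : Matrix (Fin n) (Fin m) ℂ} {V : Matrix (Fin m) (Fin n) ℂ} (hVU : V * U = 0)
    (hU : ∀ a t, i t < a → U a t = 0) (hU1 : ∀ t, U (i t) t = 1)
    (hU0 : ∀ s t, s < t → j s < j t → U (i s) t = 0)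
    (hV : ∀ s c, c < j s → V s c = 0) (hV0 : ∀ s, V s (j s) ≠ 0) :
    ∃ b, IsSlice i j b ∧ b.submatrix id i = U ∧ b⁻¹.submatrix j id = V := by
  have hVJ : (V.submatrix id j).BlockTriangular j := fun s t h => hV s (j t) h
  have hdet : (V.submatrix id j).det ≠ 0 := det_ne_zero_of_blockTriangular hj hVJ hV0
  set Y := (V.submatrix id j)⁻¹ * rowSystem j V with hY
  have hYc : ∀ s c, c < j s → Y s c = 0 := by
    intro s c hc
    rw [hY, Matrix.mul_apply]
    refine Finset.sum_eq_zero fun t _ => ?_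
    rcases lt_or_ge (j t) (j s) with h | h
    · rw [inv_blockTriangular hVJ hdet h, zero_mul]
    · have h1 : rowSystem j V t c = 0 := by
        simp [rowSystem, hV t c (hc.trans_le h), (hc.trans_le h).ne']
      rw [h1, mul_zero]
  -- The columns `i t` of `b` are those of `U`. In the other columns, the rows `j s` are chosen so
  -- that `V * b` consists of the rows `j s` of the identity, and the remaining rows are those of the
  -- identity. In the columns `i t` the same equation holds because `V * U = 0`.
  let b : Matrix (Fin n) (Fin n) ℂ := Matrix.of fun r c =>
    Function.extend i (fun t => U r t)
      (fun c => Function.extend j (fun s => Y s c) (fun r => if r = c then 1 else 0) r) c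
  have hbi : ∀ r t, b r (i t) = U r t := by
    intro r t
    simp only [b, Matrix.of_apply]
    rw [hi.extend_apply]
  have hbj : ∀ s c, (∀ t, i t ≠ c) → b (j s) c = Y s c := by
    intro s c hc
    simp only [b, Matrix.of_apply]
    rw [Function.extend_apply' _ _ _ (by simpa using hc), hj.extend_apply]
  have hbo : ∀ r c, (∀ s, j s ≠ r) → (∀ t, i t ≠ c) → b r c = if r = c then 1 else 0 := by
    intro r c hr hc
    simp only [b, Matrix.of_apply]
    rw [Function.extend_apply' _ _ _ (by simpa using hc),
      Function.extend_apply' _ _ _ (by simpa using hr)]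
  have hVb : V * b = (1 : Matrix (Fin n) (Fin n) ℂ).submatrix j id := by
    ext s c
    by_cases hc : ∃ t, i t = c
    · obtain ⟨t, rfl⟩ := hc
      have h1 : (V * b) s (i t) = (V * U) s t := by
        simp only [Matrix.mul_apply, hbi]
      simp [h1, hVU, (hne t s).symm]
    · push Not at hc
      rw [mul_apply_of_apply_other hj V b hbo s hc]
      have h1 : (V.submatrix id j * b.submatrix j id) s c = (V.submatrix id j * Y) s c := by
        rw [Matrix.mul_apply, Matrix.mul_apply]
        exact Finset.sum_congr rfl fun t _ => congrArg _ (hbj t c hc)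
      rw [h1, hY, ← Matrix.mul_assoc, Matrix.mul_nonsing_inv _ (isUnit_iff_ne_zero.2 hdet),
        Matrix.one_mul]
      exact sub_add_cancel _ _
  have hupper : b.BlockTriangular id := by
    intro r c hcr
    change c < r at hcr
    by_cases hc : ∃ t, i t = c
    · obtain ⟨t, rfl⟩ := hc
      rw [hbi, hU r t hcr]
    push Not at hc
    by_cases hr : ∃ s, j s = r
    · obtain ⟨s, rfl⟩ := hr
      rw [hbj s c hc, hYc s c hcr]
    push Not at hr
    rw [hbo r c hr hc, if_neg hcr.ne']
  have hslice : IsSlice i j b :=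
    { upper := hupper
      diag_ne_zero := by
        intro r
        by_cases hc : ∃ t, i t = r
        · obtain ⟨t, rfl⟩ := hc
          simp [hbi, hU1]
        push Not at hc
        by_cases hr : ∃ s, j s = r
        · obtain ⟨s, rfl⟩ := hr
          -- The diagonal entries of `b` and of `V` at `j s` are inverse to each other.
          have h1 : (V * b) s (j s) = V s (j s) * b (j s) (j s) := by
            rw [Matrix.mul_apply]
            refine Finset.sum_eq_single (j s) (fun r _ hr => ?_) (by simp)
            rcases lt_or_gt_of_ne hr with h | h
            · rw [hV s r h, zero_mul]
            · rw [hupper h, mul_zero]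
          rw [hVb] at h1
          have h2 : (1 : Matrix (Fin n) (Fin n) ℂ).submatrix j id s (j s) = 1 :=
            Matrix.one_apply_eq _
          rw [h2] at h1
          exact right_ne_zero_of_mul (h1 ▸ one_ne_zero)
        push Not at hr
        rw [hbo r r hr hc]
        simp
      apply_self := fun s => by rw [hbi, hU1]
      apply_eq_zero := fun s t hst hjst => by rw [hbi, hU0 s t hst hjst]
      apply_other := hbo }
  refine ⟨b, hslice, ?_, ?_⟩
  · ext r t
    exact hbi r t
  · rw [← one_submatrix_mul_eq_submatrix, ← hVb, Matrix.mul_assoc,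
      Matrix.mul_nonsing_inv _ (isUnit_iff_ne_zero.2 hslice.det_ne_zero), Matrix.mul_one]

/-- Every point of the Borel orbit is reached from the slice. -/
theorem exists_isSlice_conj_eq {n m : ℕ} {i j : Fin m → Fin n} (hi : StrictMono i)
    (hj : Function.Injective j) (hne : ∀ s t, i s ≠ j t) {β : Matrix (Fin n) (Fin n) ℂ}
    (hβ : β.BlockTriangular id) (hd : β.det ≠ 0) :
    ∃ b, IsSlice i j b ∧ b * pairMatrix i j * b⁻¹ = β * pairMatrix i j * β⁻¹ := by
  have hβi := inv_blockTriangular hβ hd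
  have hdiag : ∀ r, β r r ≠ 0 := by
    intro r hr
    have h := mul_apply_self_of_blockTriangular Function.injective_id hβ hβi r
    rw [Matrix.mul_nonsing_inv _ (isUnit_iff_ne_zero.2 hd), Matrix.one_apply_eq, hr,
      zero_mul] at h
    exact one_ne_zero h
  obtain ⟨g, hg, hgj, hred⟩ := exists_incidence_reduction j (M := β.submatrix i i)
    (fun s t h => hβ (hi h)) (fun s => hdiag _)
  -- As `g` is triangular for both orders, so is its inverse, and the shapes of the two factors
  -- `β.submatrix id i * g` and `g⁻¹ * β⁻¹.submatrix j id` are those of the original ones.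
  have hMg : ∀ s, β (i s) (i s) * g s s = 1 := by
    intro s
    have h := mul_apply_self_of_blockTriangular (M := β.submatrix i i) Function.injective_id
      (fun s t h => hβ (hi h)) hg s
    rw [hred s s le_rfl le_rfl, if_pos rfl] at h
    exact h.symm
  have hgd : g.det ≠ 0 := det_ne_zero_of_blockTriangular Function.injective_id hg
    fun s => right_ne_zero_of_mul ((hMg s).trans_ne one_ne_zero)
  have hgi := inv_blockTriangular hg hgd
  have hgij := inv_blockTriangular hgj hgd
  obtain ⟨b, hb, hbU, hbV⟩ : ∃ b, IsSlice i j b ∧ b.submatrix id i = β.submatrix id i * g ∧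
      b⁻¹.submatrix j id = g⁻¹ * β⁻¹.submatrix j id := by
    refine exists_isSlice_of_factorization hi.injective hj hne ?_ ?_ ?_ ?_ ?_ ?_
    · have h1 : β⁻¹.submatrix j id * β.submatrix id i = 0 := by
        ext s t
        have h2 : (β⁻¹ * β) (j s) (i t) = 0 := by
          rw [Matrix.nonsing_inv_mul _ (isUnit_iff_ne_zero.2 hd), Matrix.one_apply_ne (hne t s).symm]
        exact h2
      rw [Matrix.mul_assoc, ← Matrix.mul_assoc _ _ g, h1, Matrix.zero_mul, Matrix.mul_zero]
    · intro a t hat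
      rw [Matrix.mul_apply]
      refine Finset.sum_eq_zero fun s _ => ?_
      rcases lt_or_ge t s with h | h
      · rw [hg h, mul_zero]
      · rw [Matrix.submatrix_apply, id_eq, hβ ((hi.monotone h).trans_lt hat), zero_mul]
    · intro t
      exact (hred t t le_rfl le_rfl).trans (if_pos rfl)
    · intro s t hst hjst
      exact (hred s t hst.le hjst.le).trans (if_neg hst.ne)
    · intro s c hc
      rw [Matrix.mul_apply]
      refine Finset.sum_eq_zero fun t _ => ?_
      rcases lt_or_ge (j t) (j s) with h | h
      · rw [hgij h, zero_mul]
      · rw [Matrix.submatrix_apply, id_eq, hβi (hc.trans_le h), mul_zero]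
    · intro s
      have h1 := mul_apply_self_of_blockTriangular (N := β⁻¹.submatrix j j) hj hgij
        (fun s t h => hβi h) s
      refine (h1 : (g⁻¹ * β⁻¹.submatrix j id) s (j s) = _).trans_ne (mul_ne_zero ?_ ?_)
      · exact inv_apply_self_ne_zero_of_blockTriangular Function.injective_id hg hgd s
      · exact inv_apply_self_ne_zero_of_blockTriangular Function.injective_id hβ hd (j s)
  refine ⟨b, hb, ?_⟩
  rw [mul_pairMatrix_mul, mul_pairMatrix_mul, hbU, hbV, Matrix.mul_assoc,
    ← Matrix.mul_assoc g, Matrix.mul_nonsing_inv _ (isUnit_iff_ne_zero.2 hgd), Matrix.one_mul]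

/-! ### Regularity of the orbit map and of its inverse -/

/-- The orbit map on the slice. -/
noncomputable def sliceOrbit {n m : ℕ} {i j : Fin m → Fin n} (x : SliceCoord i j) :
    Matrix (Fin n) (Fin n) ℂ :=
  sliceMatrix x * pairMatrix i j * (sliceMatrix x)⁻¹

/-- The orbit map on the slice is regular. -/
theorem sliceOrbit_mem_regularFunctions {n m : ℕ} {i j : Fin m → Fin n}
    (hi : Function.Injective i) (r c : Fin n) :
    (fun x : SliceCoord i j => sliceOrbit x r c) ∈
      regularFunctions (Subtype.val : SliceCoord i j → _) := by
  have hb : ∀ r c, (fun x : SliceCoord i j => sliceMatrix x r c) ∈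
      regularFunctions (Subtype.val : SliceCoord i j → _) := by
    intro r c
    by_cases h : (r, c) ∈ slicePositions i j
    · simp only [sliceMatrix_of_mem _ h]
      exact coord_mem_regularFunctions _
    · simp only [sliceMatrix_of_notMem _ h]
      exact const_mem_regularFunctions _
  have hbi := inv_mem_regularFunctions hb fun x => (isSlice_sliceMatrix hi x).det_ne_zero
  simp only [sliceOrbit, mul_pairMatrix_mul_apply]
  exact sum_mem_regularFunctions _ fun s _ => mul_mem_regularFunctions (hb _ _) (hbi _ _)

/-- The columns of the slice matrix indexed by `i` and the rows of its inverse indexed by `j` are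
regular functions of the point of the orbit. Writing the point as `∑ s, u s ⊗ v s`, its row `i t`
is `v t` plus a combination of the `v s` with `j s < j t`, and its column `j t` is a multiple of
`u t` plus a combination of the `u s` with `j s < j t`; so the factors are found by recursion
on `j t`. -/
theorem slice_factors_mem_regularFunctions {n m : ℕ} {i j : Fin m → Fin n} (hi : StrictMono i)
    (hj : Function.Injective j) (t : Fin m) :
    (∀ a, (fun x : SliceCoord i j => sliceMatrix x a (i t)) ∈
      regularFunctions fun x : SliceCoord i j => fun p : Fin n × Fin n => sliceOrbit x p.1 p.2) ∧
    ∀ c, (fun x : SliceCoord i j => (sliceMatrix x)⁻¹ (j t) c) ∈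
      regularFunctions fun x : SliceCoord i j => fun p : Fin n × Fin n =>
        sliceOrbit x p.1 p.2 := by
  set φ := fun x : SliceCoord i j => fun p : Fin n × Fin n => sliceOrbit x p.1 p.2 with hφ
  have hA : ∀ a c, (fun x => sliceOrbit x a c) ∈ regularFunctions φ :=
    fun a c => coord_mem_regularFunctions (φ := φ) (a, c)
  have hS := fun x : SliceCoord i j => isSlice_sliceMatrix hi.injective x
  have hinv := fun x => inv_blockTriangular (hS x).upper (hS x).det_ne_zero
  have hprod : ∀ (x : SliceCoord i j) a c, sliceOrbit x a c =
      ∑ s, sliceMatrix x a (i s) * (sliceMatrix x)⁻¹ (j s) c :=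
    fun x a c => mul_pairMatrix_mul_apply i j _ _ a c
  induction h : j t using WellFoundedLT.induction generalizing t with
  | ind p ih =>
  subst h
  have hsum : ∀ a c, (fun x : SliceCoord i j => ∑ s with j s < j t,
      sliceMatrix x a (i s) * (sliceMatrix x)⁻¹ (j s) c) ∈ regularFunctions φ := by
    intro a c
    refine sum_mem_regularFunctions _ fun s hs => ?_
    have := ih (j s) (Finset.mem_filter.1 hs).2 s rfl
    exact mul_mem_regularFunctions (this.1 a) (this.2 c)
  have hsplit : ∀ (x : SliceCoord i j) a c,
      (∀ s, j t < j s → sliceMatrix x a (i s) * (sliceMatrix x)⁻¹ (j s) c = 0) →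
      sliceMatrix x a (i t) * (sliceMatrix x)⁻¹ (j t) c = sliceOrbit x a c -
        ∑ s with j s < j t, sliceMatrix x a (i s) * (sliceMatrix x)⁻¹ (j s) c := by
    intro x a c h0
    rw [hprod, eq_sub_iff_add_eq, Finset.sum_filter,
      ← Finset.add_sum_erase Finset.univ _ (Finset.mem_univ t),
      ← Finset.add_sum_erase Finset.univ (fun s => sliceMatrix x a (i s) * _) (Finset.mem_univ t),
      if_neg (lt_irrefl _), zero_add]
    congr 1
    refine Finset.sum_congr rfl fun s hs => ?_
    split_ifs with hlt
    · rfl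
    · exact (h0 s (lt_of_le_of_ne (not_lt.1 hlt) (hj.ne (Finset.ne_of_mem_erase hs).symm))).symm
  have hv : ∀ c, (fun x : SliceCoord i j => (sliceMatrix x)⁻¹ (j t) c) ∈ regularFunctions φ := by
    intro c
    have key : ∀ x : SliceCoord i j, (sliceMatrix x)⁻¹ (j t) c = sliceOrbit x (i t) c -
        ∑ s with j s < j t, sliceMatrix x (i t) (i s) * (sliceMatrix x)⁻¹ (j s) c := by
      intro x
      rw [← hsplit x (i t) c, (hS x).apply_self, one_mul]
      intro s hs
      rcases lt_trichotomy s t with h | h | h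
      · rw [(hS x).upper (hi h), zero_mul]
      · exact absurd (h ▸ hs) (lt_irrefl _)
      · rw [(hS x).apply_eq_zero t s h hs, zero_mul]
    simp only [key]
    exact sub_mem_regularFunctions (hA _ _) (hsum _ _)
  refine ⟨fun a => ?_, hv⟩
  have hne : ∀ x : SliceCoord i j, (sliceMatrix x)⁻¹ (j t) (j t) ≠ 0 := fun x =>
    inv_apply_self_ne_zero_of_blockTriangular Function.injective_id (hS x).upper
      (hS x).det_ne_zero _
  have key : ∀ x : SliceCoord i j, sliceMatrix x a (i t) = (sliceOrbit x a (j t) -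
      ∑ s with j s < j t, sliceMatrix x a (i s) * (sliceMatrix x)⁻¹ (j s) (j t)) /
        (sliceMatrix x)⁻¹ (j t) (j t) := by
    intro x
    rw [← hsplit x a (j t), mul_div_cancel_right₀ _ (hne x)]
    intro s hs
    rw [hinv x hs, mul_zero]
  simp only [key]
  exact div_mem_regularFunctions (sub_mem_regularFunctions (hA _ _) (hsum _ _)) (hv _) hne

/-- The coordinates of the slice are regular functions of the point of the orbit. -/
theorem sliceCoord_mem_regularFunctions {n m : ℕ} {i j : Fin m → Fin n} (hi : StrictMono i)
    (hj : Function.Injective j) (p : slicePositions i j) :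
    (fun x : SliceCoord i j => x.1 p) ∈
      regularFunctions fun x : SliceCoord i j => fun p : Fin n × Fin n =>
        sliceOrbit x p.1 p.2 := by
  set φ := fun x : SliceCoord i j => fun p : Fin n × Fin n => sliceOrbit x p.1 p.2 with hφ
  obtain ⟨⟨r, c⟩, hp⟩ := p
  simp only [← sliceMatrix_of_mem _ hp]
  by_cases hc : ∃ t, i t = c
  · obtain ⟨t, rfl⟩ := hc
    exact (slice_factors_mem_regularFunctions hi hj t).1 r
  obtain ⟨s, rfl⟩ := (mem_slicePositions.1 hp).2.1.resolve_left hc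
  push Not at hc
  have hS := fun x : SliceCoord i j => isSlice_sliceMatrix hi.injective x
  have hdet : ∀ x : SliceCoord i j,
      (((sliceMatrix x)⁻¹.submatrix j id).submatrix id j).det ≠ 0 := fun x =>
    det_ne_zero_of_blockTriangular hj
      (fun s t h => inv_blockTriangular (hS x).upper (hS x).det_ne_zero h)
      fun s => inv_apply_self_ne_zero_of_blockTriangular Function.injective_id (hS x).upper
        (hS x).det_ne_zero _
  have hVb : ∀ x : SliceCoord i j, (sliceMatrix x)⁻¹.submatrix j id * sliceMatrix x =
      (1 : Matrix (Fin n) (Fin n) ℂ).submatrix j id := by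
    intro x
    rw [← one_submatrix_mul_eq_submatrix, Matrix.mul_assoc,
      Matrix.nonsing_inv_mul _ (isUnit_iff_ne_zero.2 (hS x).det_ne_zero), Matrix.mul_one]
  simp only [fun x : SliceCoord i j =>
    apply_eq_inv_mul_rowSystem hj (hS x).apply_other (hdet x) (hVb x) s hc, Matrix.mul_apply]
  refine sum_mem_regularFunctions _ fun t _ => mul_mem_regularFunctions ?_ ?_
  · exact inv_mem_regularFunctions
      (fun a b => (slice_factors_mem_regularFunctions hi hj a).2 (j b)) hdet s t
  · simp only [rowSystem, Matrix.of_apply]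
    refine sub_mem_regularFunctions (const_mem_regularFunctions _) ?_
    split_ifs
    · exact const_mem_regularFunctions _
    · exact (slice_factors_mem_regularFunctions hi hj t).2 c

/-! ### The dimension of the orbit -/

theorem eq_of_mem_regularFunctions {X σ : Type*} {φ : X → σ → ℂ} {f : X → ℂ}
    (hf : f ∈ regularFunctions φ) {x y : X} (h : φ x = φ y) : f x = f y := by
  obtain ⟨P, Q, hPQ⟩ := hf
  rw [(hPQ x).2, (hPQ y).2, h]

theorem sliceOrbit_mem_borelOrbit {n m : ℕ} {i j : Fin m → Fin n} (hi : Function.Injective i)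
    (x : SliceCoord i j) : sliceOrbit x ∈ borelOrbit (pairMatrix i j) := by
  have hS := isSlice_sliceMatrix hi x
  refine ⟨Matrix.GeneralLinearGroup.mkOfDetNeZero _ hS.det_ne_zero,
    fun r c h => hS.upper h, ?_⟩
  rw [Matrix.coe_units_inv]
  rfl

theorem exists_sliceOrbit_eq {n m : ℕ} {i j : Fin m → Fin n} (hi : StrictMono i)
    (hj : Function.Injective j) (hne : ∀ s t, i s ≠ j t) {A : Matrix (Fin n) (Fin n) ℂ}
    (hA : A ∈ borelOrbit (pairMatrix i j)) : ∃ x : SliceCoord i j, sliceOrbit x = A := by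
  obtain ⟨β, hβ, rfl⟩ := hA
  obtain ⟨b, hb, h⟩ := exists_isSlice_conj_eq hi hj hne (β := (β : Matrix (Fin n) (Fin n) ℂ))
    (fun r c h => hβ r c h) β.det_ne_zero
  obtain ⟨x, rfl⟩ := hb.exists_sliceMatrix_eq hi hj
  exact ⟨x, by rw [sliceOrbit, h, Matrix.coe_units_inv]⟩

/-- The slice is homeomorphic to the Borel orbit for the Zariski topologies, as the orbit map
and its inverse are regular. -/
theorem zariskiDim_borelOrbit_pairMatrix {n m : ℕ} {i j : Fin m → Fin n} (hi : StrictMono i)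
    (hj : Function.Injective j) (hne : ∀ s t, i s ≠ j t) :
    zariskiDim (borelOrbit (pairMatrix i j)) = ((slicePositions i j).card : WithBot ℕ∞) := by
  set φ := fun x : SliceCoord i j => fun p : Fin n × Fin n => sliceOrbit x p.1 p.2 with hφ
  have htop : zariskiOf (Subtype.val : SliceCoord i j → _) = zariskiOf φ :=
    le_antisymm (zariskiOf_le fun p => sliceOrbit_mem_regularFunctions hi.injective p.1 p.2)
      (zariskiOf_le fun p => sliceCoord_mem_regularFunctions hi hj p)
  let f : SliceCoord i j → borelOrbit (pairMatrix i j) := fun x =>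
    ⟨sliceOrbit x, sliceOrbit_mem_borelOrbit hi.injective x⟩
  let _ : TopologicalSpace (SliceCoord i j) := zariskiOf Subtype.val
  let _ : TopologicalSpace (borelOrbit (pairMatrix i j)) :=
    TopologicalSpace.induced Subtype.val (zariskiTopology n)
  have hind : IsInducing f := ⟨by
    refine htop.trans ?_
    rw [induced_compose, zariskiTopology, induced_compose]
    rfl⟩
  have hinj : Function.Injective f := by
    intro x y hxy
    have h1 : φ x = φ y := by
      ext p
      exact congrFun (congrFun (congrArg Subtype.val hxy) p.1) p.2
    ext p
    exact eq_of_mem_regularFunctions (sliceCoord_mem_regularFunctions hi hj p) h1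
  have hsurj : Function.Surjective f := fun ⟨A, hA⟩ => by
    obtain ⟨x, hx⟩ := exists_sliceOrbit_eq hi hj hne hA
    exact ⟨x, Subtype.ext hx⟩
  have hhom : IsHomeomorph f := isHomeomorph_iff_isEmbedding_surjective.2 ⟨⟨hind, hinj⟩, hsurj⟩
  have h2 := hhom.topologicalKrullDim_eq
  rw [zariskiDim, ← h2, topologicalKrullDim_zariskiOf_coord_ne_zero, Fintype.card_coe]

theorem mainTheorem7 (n m : ℕ) (hm : 2 * m ≤ n) (w : Equiv.Perm (Fin n))
    (i j : Fin m → Fin n) (k : Fin (n - 2 * m) → Fin n)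
    (hi : StrictMono i) (hij : ∀ s, i s < j s)
    (hdisj : Function.Injective (Sum.elim i j))
    (hw : w = (List.ofFn fun s => Equiv.swap (i s) (j s)).prod)
    (hk : StrictMono k) (hfix : Set.range k = {a | w a = a}) :
    ∃ π : Equiv.Perm (Fin n),
      List.ofFn (fun a => π a) = List.ofFn i ++ List.ofFn k ++ List.ofFn j ∧
      (permGL π : Matrix (Fin n) (Fin n) ℂ) * upperPart (minimalInvolution n m hm) *
          ((permGL π)⁻¹ : GL (Fin n) ℂ) = upperPart w ∧
      zariskiDim (borelOrbit (upperPart w)) =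
        ((coxeterLength π + m * (m + 1) / 2 : ℕ) : WithBot ℕ∞) := by
  subst hw
  have hj : Function.Injective j := fun a b hab => Sum.inr_injective (hdisj (by simpa using hab))
  have hne : ∀ a b, i a ≠ j b := fun a b hab => Sum.inl_ne_inr (hdisj (by simpa using hab))
  have hkfix : ∀ l, (List.ofFn fun s => Equiv.swap (i s) (j s)).prod (k l) = k l := fun l =>
    (Set.ext_iff.1 hfix (k l)).1 ⟨l, rfl⟩
  have hki : ∀ l s, k l ≠ i s := by
    intro l s h
    have h1 := hkfix l
    rw [h, (prod_swap_apply i j hdisj s).1] at h1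
    exact hne s s h1.symm
  have hkj : ∀ l s, k l ≠ j s := by
    intro l s h
    have h1 := hkfix l
    rw [h, (prod_swap_apply i j hdisj s).2] at h1
    exact hne s s h1
  obtain ⟨π, hπ, hπi, hπk, hπj⟩ := exists_perm_ofFn_eq_append hm i j k hdisj hk.injective hki hkj
  refine ⟨π, hπ, ?_, ?_⟩
  · ext a b
    rw [permGL_conj_apply, upperPart_prod_swap_apply i j hij hdisj,
      upperPart_minimalInvolution_apply]
    refine if_congr (exists_congr fun s => and_congr ?_ ?_) rfl rfl
    · rw [← hπi s, ← Equiv.symm_apply_eq, Fin.ext_iff]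
    · rw [← hπj s, ← Equiv.symm_apply_eq, Fin.ext_iff]
  · have hN : upperPart (List.ofFn fun s => Equiv.swap (i s) (j s)).prod = pairMatrix i j := by
      ext a b
      rw [upperPart_prod_swap_apply i j hij hdisj, pairMatrix_apply hi.injective]
    rw [hN, zariskiDim_borelOrbit_pairMatrix hi hj hne,
      card_slicePositions hm hi hdisj hk π hπi hπk hπj, coxeterLength_eq_card_inversions]
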